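/- Let $\tau\neq 0$ be a constant. Consider the symmetry-preserving difference scheme for the potential Burgers equation $w_t=w_{xx}-\frac12 w_x^2$ on the four points $P=(m,n)$, $P_\pm=(m\pm1,n)$, $\hat P=(m,n+1)$, with values $(x,t,w)$, $(x_\pm,t_\pm,w_\pm)$, $(\hat x,\hat t,\hat w)$, $h^+=x_+-x>0$, $h^-=x-x_->0$, $\Delta x=\hat x-x$: $$\frac{\Delta x}{\hat t-t}=\frac{1}{h^++h^-}\Big[\frac{h^-}{h^+}(w_+-w)+\frac{h^+}{h^-}(w-w_-)\Big],$$ $$e^{\hat w-w-\frac{(\Delta x)^2}{2(\hat t-t)}}=1+\frac{2(\hat t-t)}{h^++h^-}\Big[\frac{w_+-w}{h^+}-\frac{w-w_-}{h^-}\Big],$$ $$\hat t-t=\tau,\qquad t_+=t_-=t .$$ Let $\hat X=\xi(x,t,w)\,y\,\partial_x+\phi(x,t,w)\,s\,\partial_t+\psi(x,t,w)\,u\,\partial_w$ with arbitrary real functions $\xi,\phi,\psi$, where $(y,s,u)$ are solutions of the linear scheme in which $u_{m,n+1}$, $s_{m,n+1}$ and $y_{m,n+1}$ are linear combinations of $u_{m,n},u_{m-1,n},u_{m+1,n},y_{m,n},y_{m-1,n},y_{m+1,n},s_{m,n},s_{m-1,n},s_{m+1,n}$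 (in this order) with coefficients $a_1,\dots,a_9$, $b_1,\dots,b_9$ and $c_1,\dots,c_9$ respectively, which may depend on $m,n$. An equation $E=0$ of the scheme is *preserved* by $\hat X$ if, for all $(m,n)$ and all stencils satisfying the whole scheme, the prolongation of $\hat X$ (its value at each of the four points) annihilates $E$ for every such $(y,s,u)$. Call $(y,s,u)$ *row-constant* if $s_{m+1,n}=s_{m-1,n}=s_{m,n}$ (the linear counterpart of $t_+=t_-=t$). Then: 1. (Local form.) Let $U\subset\mathbb R^3$ be open, and suppose that the first three equations (those that determine $\hat x,\hat w,\hat t$) are preserved, only on stencils with all four points in $U$ and only for row-constant $(y,s,u)$. Then on every stencil of the scheme in $U$: $\xi$ and $\psi$ vanish at $P,P_+,P_-$; the $\partial_x$- and $\partial_w$-components of the prolonged generator vanish at all four points for all row-constant $(y,s,u)$; and near $P$, among points with the same $t$ as $P$, $\phi$ is constant. 2. For $\xi,\phi,\psi$ defined on all of $\mathbb R^3$, the first three equations are preserved for all $(y,s,u)$ if and only if $\xi=\psi=0$ and either $\phi=0$, or $b_j=0$ for all $j\ne7$, $b_7=\beta\neq0$ is independent of $m,n$, and $\phi=\phi_0(t)$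 with $\phi_0(t+k\tau)=\beta^{-k}\phi_0(t)$ for all $k\in\mathbb Z$, $t\in\mathbb R$. Thus the only such generator is $b_7^{-n}s\,\partial_t$ (up to a constant factor, on the lattice $t=t_0+n\tau$). 3. For $\xi,\phi,\psi$ defined on all of $\mathbb R^3$, all five equations are preserved for all row-constant $(y,s,u)$ if and only if $\xi=\psi=0$ and either $\phi=0$, or $b_1=\dots=b_6=0$, $b_7+b_8+b_9=\beta\ne0$ is independent of $m,n$, and $\phi=\phi_0(t)$ with $\phi_0(t+k\tau)=\beta^{-k}\phi_0(t)$ for all $k\in\mathbb Z$, $t\in\mathbb R$. 4. For $\xi,\phi,\psi$ defined on all of $\mathbb R^3$, all five equations are preserved for all $(y,s,u)$ only if $\xi=\phi=\psi=0$. 5. The scheme is not linearizable by a point transformation, even locally: there are no open $U\subset\mathbb R^3$ containing the four points of some stencil of the scheme and injective $C^1$ map $\Phi:U\to\mathbb R^3$ with invertible derivative such that, in the variables $\Phi(x,t,w)$, all stencils of the scheme in $U$ satisfy one linear scheme of the above kind (with coefficients depending on $m,n$, and possibly with inhomogeneous terms). 6. The corresponding scheme for the heat equation, obtained for $u>0$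 by the substitution $w=-2\log u$, is not a linear scheme: there is no open set containing the four points of some stencil of it on which all its stencils $(x,t,u)$ satisfy one linear scheme of the above kind, possibly with inhomogeneous terms. -/

import Mathlib

open Set Filter Topology

/-- The space of the variables `(x, t, w)`: `p.1 = x`, `p.2.1 = t`, `p.2.2 = w`. -/
abbrev Pt : Type := ℝ × ℝ × ℝ

/-- The four nodes of the stencil with reference point `(m, n)`:
`left = (m-1, n)`, `mid = (m, n)`, `right = (m+1, n)`, `up = (m, n+1)`. -/
inductive Node : Type
  | left
  | mid
  | right
  | up

/-- Values of three lattice variables at the four nodes of a stencil. -/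
abbrev Stencil : Type := Node → Pt

namespace Stencil

/-- `h⁺ = x_{m+1,n} - x_{m,n}`. -/
def hPlus (S : Stencil) : ℝ := (S .right).1 - (S .mid).1

/-- `h⁻ = x_{m,n} - x_{m-1,n}`. -/
def hMinus (S : Stencil) : ℝ := (S .mid).1 - (S .left).1

/-- `Δx = x_{m,n+1} - x_{m,n}`. -/
def dx (S : Stencil) : ℝ := (S .up).1 - (S .mid).1

/-- `t_{m,n+1} - t_{m,n}`. -/
def dt (S : Stencil) : ℝ := (S .up).2.1 - (S .mid).2.1

/-- `w₊ - w`. -/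
def dwPlus (S : Stencil) : ℝ := (S .right).2.2 - (S .mid).2.2

/-- `w - w₋`. -/
def dwMinus (S : Stencil) : ℝ := (S .mid).2.2 - (S .left).2.2

/-- `ŵ - w`. -/
def dwUp (S : Stencil) : ℝ := (S .up).2.2 - (S .mid).2.2

end Stencil

/-- Names of the five equations of the scheme. -/
inductive SchemeEq : Type
  | mesh
  | evolution
  | timeStep
  | rowRight
  | rowLeft

/-- The left-hand sides `E_a` of the five equations `E_a = 0` of the symmetry-preserving scheme for
the potential Burgers equation with constant time step `τ`. -/
noncomputable def schemeFun (τ : ℝ) : SchemeEq → Stencil → ℝ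
  | .mesh, S =>
      S.dx / S.dt - 1 / (S.hPlus + S.hMinus) *
        (S.hMinus / S.hPlus * S.dwPlus + S.hPlus / S.hMinus * S.dwMinus)
  | .evolution, S =>
      Real.exp (S.dwUp - S.dx ^ 2 / (2 * S.dt)) -
        (1 + 2 * S.dt / (S.hPlus + S.hMinus) * (S.dwPlus / S.hPlus - S.dwMinus / S.hMinus))
  | .timeStep, S => S.dt - τ
  | .rowRight, S => (S .right).2.1 - (S .mid).2.1
  | .rowLeft, S => (S .left).2.1 - (S .mid).2.1

/-- The stencil `S` satisfies the potential Burgers scheme (on a lattice ordered by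
`x_{m-1,n} < x_{m,n} < x_{m+1,n}`). -/
def BurgersScheme (τ : ℝ) (S : Stencil) : Prop :=
  0 < S.hPlus ∧ 0 < S.hMinus ∧ ∀ a, schemeFun τ a S = 0

/-- The corresponding scheme for the heat equation, for stencils with values `(x, t, u)`, `u > 0`:
`w = -2 log u` satisfies the potential Burgers scheme. -/
def HeatScheme (τ : ℝ) (S : Stencil) : Prop :=
  (∀ i, 0 < (S i).2.2) ∧
    BurgersScheme τ (fun i => ((S i).1, (S i).2.1, -2 * Real.log (S i).2.2))

/-- The coefficients `a_j`, `b_j`, `c_j` (`j = 1, …, 9`, stored at index `j - 1`) of a linear scheme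
at one lattice point; `a` belongs to the equation for `u`, `b` to the one for `s`, `c` to the one
for `y`. -/
structure LinearCoeffs : Type where
  a : Fin 9 → ℝ
  b : Fin 9 → ℝ
  c : Fin 9 → ℝ

/-- For a stencil of values `(y, s, u)`, the combination
`k₁ u_{m,n} + k₂ u_{m-1,n} + k₃ u_{m+1,n} + k₄ y_{m,n} + k₅ y_{m-1,n} + k₆ y_{m+1,n}
+ k₇ s_{m,n} + k₈ s_{m-1,n} + k₉ s_{m+1,n}`. -/
def linComb (k : Fin 9 → ℝ) (σ : Stencil) : ℝ :=
  k 0 * (σ .mid).2.2 + k 1 * (σ .left).2.2 + k 2 * (σ .right).2.2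
    + k 3 * (σ .mid).1 + k 4 * (σ .left).1 + k 5 * (σ .right).1
    + k 6 * (σ .mid).2.1 + k 7 * (σ .left).2.1 + k 8 * (σ .right).2.1

/-- The value of `(y, s, u)` at `(m, n+1)` that the linear scheme prescribes. -/
def linStep (L : LinearCoeffs) (σ : Stencil) : Pt :=
  (linComb L.c σ, linComb L.b σ, linComb L.a σ)

/-- The functions `ξ, φ, ψ` of `(x, t, w)` of a generator
`ξ y ∂_x + φ s ∂_t + ψ u ∂_w`. -/
structure Generator : Type where
  ξ : Pt → ℝ
  φ : Pt → ℝ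
  ψ : Pt → ℝ

/-- The prolonged vector field: its `(∂_x, ∂_t, ∂_w)` components at each of the four points of the
stencil `S`, for the values `σ = (y, s, u)` at these points. -/
def Generator.prolong (X : Generator) (S σ : Stencil) : Stencil := fun i =>
  (X.ξ (S i) * (σ i).1, X.φ (S i) * (σ i).2.1, X.ψ (S i) * (σ i).2.2)

/-- `pr X E_a = 0` on the solutions of the scheme with all points in `U`, for the equations `E_a`
with `a ∈ A`, and for every solution `σ = (y, s, u)` of the linear scheme with coefficients `L`
(depending on the lattice indices) that satisfies the side condition `D`. -/
def IsSymmetryOn (τ : ℝ) (U : Set Pt) (A : Set SchemeEq) (D : Stencil → Prop)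
    (L : ℤ → ℤ → LinearCoeffs) (X : Generator) : Prop :=
  ∀ (m n : ℤ) (S σ : Stencil), (∀ i, S i ∈ U) → BurgersScheme τ S →
    σ .up = linStep (L m n) σ → D σ →
      ∀ a ∈ A, HasLineDerivAt ℝ (schemeFun τ a) 0 S (X.prolong S σ)

/-- The equations of the scheme that determine the point `(m, n+1)`. -/
def stepEqs : Set SchemeEq := {.mesh, .evolution, .timeStep}

/-- No side condition on `(y, s, u)`. -/
def AllSolutions (_ : Stencil) : Prop := True

/-- `s_{m+1,n} = s_{m-1,n} = s_{m,n}`: the linear equations that correspond to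
`t_{m+1,n} = t_{m-1,n} = t_{m,n}`. -/
def RowConstant (σ : Stencil) : Prop :=
  (σ .right).2.1 = (σ .mid).2.1 ∧ (σ .left).2.1 = (σ .mid).2.1

/-- `Φ` is a local change of the variables `(x, t, w)` on the open set `U`. -/
def IsPointTransformation (Φ : Pt → Pt) (U : Set Pt) : Prop :=
  IsOpen U ∧ ContDiffOn ℝ 1 Φ U ∧ InjOn Φ U ∧ ∀ p ∈ U, (fderiv ℝ Φ p).IsInvertible

/-- In the new variables `Φ (x, t, w)`, every solution with points in `U` of the scheme `E` solves
one linear (possibly inhomogeneous) scheme, with coefficients depending on the lattice indices. -/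
def BecomesLinear (E : Stencil → Prop) (Φ : Pt → Pt) (U : Set Pt) : Prop :=
  ∃ (L : ℤ → ℤ → LinearCoeffs) (d : ℤ → ℤ → Pt), ∀ (m n : ℤ) (S : Stencil),
    (∀ i, S i ∈ U) → E S → Φ (S .up) = linStep (L m n) (fun i => Φ (S i)) + d m n

/-- The scheme `E` is linearizable by a point transformation, at least locally, i.e. on an open set
that contains all points of some stencil of the scheme. -/
def IsLinearizable (E : Stencil → Prop) : Prop :=
  ∃ (U : Set Pt) (Φ : Pt → Pt), IsPointTransformation Φ U ∧
    (∃ S : Stencil, (∀ i, S i ∈ U) ∧ E S) ∧ BecomesLinear E Φ U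

/-- The scheme `E` is itself a linear scheme, at least locally. -/
def IsLinearScheme (E : Stencil → Prop) : Prop :=
  ∃ U : Set Pt, IsOpen U ∧ (∃ S : Stencil, (∀ i, S i ∈ U) ∧ E S) ∧ BecomesLinear E id U

/-! The mesh and evolution equations see the three lower nodes only through the slope `K` and the
quadratic coefficient `M`, at the middle node, of the parabola through them. The upper node depends
on the middle node, `K` and `M`, but not on the mesh widths `p`, `q`
(`BurgersScheme.exists_parabola`). Sliding an outer node along the parabola therefore leaves the
upper node fixed.

In a linear scheme the lower nodes contribute additively, so sliding the left node does not change
its contribution. Slides along two different parabolas combine to a vertical displacement of that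
node. This displacement changes `K`, hence the upper node, although the linear scheme assigns it the
same image; this contradicts injectivity (`not_becomesLinear_of_injOn`).

For symmetries the same idea is used infinitesimally. A variation supported at one lower node must
give the same variation of the upper abscissa for all nearby `p`, `q`. This forces `ψ u = k ξ y`
there, with `k` the slope of the parabola at the node. Since `k` can be varied with the node fixed,
`ξ = ψ = 0` (`IsSymmetryOn.lower_eq_zero`). Only the time-step condition `φ(up) s(up) = φ(mid)
s(mid)` is left. Globally, any two points at time distance `τ` are the middle and upper node of a
stencil, so `φ` is a function of `t` and `s(up) = β s(mid)` (`IsSymmetryOn.phi_classification`). -/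

/-- The stencil with nodes on the parabola `w + K (X - x) + M (X - x) ^ 2` at time `t`, with mesh
widths `p` to the right and `q` to the left, and with the upper node that the potential Burgers
scheme prescribes. -/
noncomputable def parabolaStencil (τ x t w K M p q : ℝ) : Stencil
  | .left => (x - q, t, w - K * q + M * q ^ 2)
  | .mid => (x, t, w)
  | .right => (x + p, t, w + K * p + M * p ^ 2)
  | .up => (x + τ * K, t + τ, w + τ * K ^ 2 / 2 + Real.log (1 + 2 * τ * M))

theorem burgersScheme_parabolaStencil {τ : ℝ} (hτ : τ ≠ 0) (x t w K : ℝ) {M p q : ℝ} (hp : 0 < p)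
    (hq : 0 < q) (hM : 0 < 1 + 2 * τ * M) :
    BurgersScheme τ (parabolaStencil τ x t w K M p q) := by
  have hpq : p + q ≠ 0 := by positivity
  have hp' := hp.ne'
  have hq' := hq.ne'
  refine ⟨by simpa [Stencil.hPlus, parabolaStencil], by simpa [Stencil.hMinus, parabolaStencil], ?_⟩
  rintro (_ | _ | _ | _ | _)
  · simp only [schemeFun, Stencil.dx, Stencil.dt, Stencil.hPlus, Stencil.hMinus, Stencil.dwPlus,
      Stencil.dwMinus, parabolaStencil, add_sub_cancel_left, sub_sub_cancel]
    field_simp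
    ring
  · have h1 : w + τ * K ^ 2 / 2 + Real.log (1 + 2 * τ * M) - w - (τ * K) ^ 2 / (2 * τ)
        = Real.log (1 + 2 * τ * M) := by
      field_simp
      ring
    simp only [schemeFun, Stencil.dx, Stencil.dt, Stencil.hPlus, Stencil.hMinus, Stencil.dwPlus,
      Stencil.dwMinus, Stencil.dwUp, parabolaStencil, add_sub_cancel_left, sub_sub_cancel, h1,
      Real.exp_log hM]
    field_simp
    ring
  all_goals simp [schemeFun, Stencil.dt, parabolaStencil]

/-- `K` and `M` come from interpolation at the three lower nodes. Positivity of `1 + 2 * τ * M`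
holds because the evolution equation equates it with an exponential. -/
theorem BurgersScheme.exists_parabola {τ : ℝ} (hτ : τ ≠ 0) {S : Stencil} (h : BurgersScheme τ S) :
    ∃ x t w K M p q : ℝ, 0 < p ∧ 0 < q ∧ 0 < 1 + 2 * τ * M ∧
      S = parabolaStencil τ x t w K M p q := by
  obtain ⟨hp, hq, hS⟩ := h
  have h1 := hS .mesh
  have h2 := hS .evolution
  have h3 := hS .timeStep
  have h4 := hS .rowRight
  have h5 := hS .rowLeft
  simp only [schemeFun] at h1 h2 h3 h4 h5
  have h3' : S.dt = τ := by linarith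
  rw [h3'] at h1 h2
  have hpq : S.hPlus + S.hMinus ≠ 0 := by positivity
  have hp' := hp.ne'
  have hq' := hq.ne'
  set p := S.hPlus with hpdef
  set q := S.hMinus with hqdef
  set A := S.dwPlus with hAdef
  set B := S.dwMinus with hBdef
  set K := 1 / (p + q) * (q / p * A + p / q * B) with hK
  set M := 1 / (p + q) * (A / p - B / q) with hMdef
  have hF : 1 + 2 * τ / (p + q) * (A / p - B / q) = 1 + 2 * τ * M := by rw [hMdef]; ring
  rw [hF, sub_eq_zero] at h2
  have hdx : S.dx = τ * K := by
    rw [sub_eq_zero, div_eq_iff hτ] at h1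
    linarith
  have hM : 0 < 1 + 2 * τ * M := h2 ▸ Real.exp_pos _
  have hup : S.dwUp = τ * K ^ 2 / 2 + Real.log (1 + 2 * τ * M) := by
    rw [← h2, Real.log_exp, hdx]
    field_simp
    ring
  have hA : K * p + M * p ^ 2 = A := by
    rw [hK, hMdef]; field_simp; ring
  have hB : K * q - M * q ^ 2 = B := by
    rw [hK, hMdef]; field_simp; ring
  refine ⟨(S .mid).1, (S .mid).2.1, (S .mid).2.2, K, M, p, q, hp, hq, hM, ?_⟩
  simp only [Stencil.hPlus, Stencil.hMinus, Stencil.dwPlus, Stencil.dwMinus, Stencil.dx,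
    Stencil.dt, Stencil.dwUp] at *
  funext i
  rcases i with _ | _ | _ | _ <;>
    refine Prod.ext ?_ (Prod.ext ?_ ?_) <;> simp only [parabolaStencil] <;> linarith

theorem eventually_parabolaStencil_mem {α : Type*} [TopologicalSpace α] {τ : ℝ} {U : Set Pt}
    (hU : IsOpen U) {z : α} {x t w K M p q : α → ℝ} (hx : ContinuousAt x z)
    (ht : ContinuousAt t z) (hw : ContinuousAt w z) (hK : ContinuousAt K z)
    (hM : ContinuousAt M z) (hp : ContinuousAt p z) (hq : ContinuousAt q z) (hp0 : 0 < p z)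
    (hq0 : 0 < q z) (hM0 : 0 < 1 + 2 * τ * M z)
    (hS : ∀ i, parabolaStencil τ (x z) (t z) (w z) (K z) (M z) (p z) (q z) i ∈ U) :
    ∀ᶠ a in 𝓝 z, 0 < p a ∧ 0 < q a ∧ 0 < 1 + 2 * τ * M a ∧
      ∀ i, parabolaStencil τ (x a) (t a) (w a) (K a) (M a) (p a) (q a) i ∈ U := by
  have hM' : ContinuousAt (fun a => 1 + 2 * τ * M a) z := by fun_prop
  have key : ∀ i, ∀ᶠ a in 𝓝 z,
      parabolaStencil τ (x a) (t a) (w a) (K a) (M a) (p a) (q a) i ∈ U := by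
    intro i
    refine ContinuousAt.eventually_mem ?_ (hU.mem_nhds (hS i))
    rcases i with _ | _ | _ | _
    · simp only [parabolaStencil]; fun_prop
    · simp only [parabolaStencil]; fun_prop
    · simp only [parabolaStencil]; fun_prop
    · have := hM'.log hM0.ne'
      simp only [parabolaStencil]; fun_prop
  filter_upwards [hp.eventually (lt_mem_nhds hp0), hq.eventually (lt_mem_nhds hq0),
    hM'.eventually (lt_mem_nhds hM0), key .left, key .mid, key .right, key .up]
    with a h1 h2 h3 h4 h5 h6 h7
  refine ⟨h1, h2, h3, ?_⟩
  rintro (_ | _ | _ | _) <;> assumption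

/-! ### Linear schemes and point transformations -/

theorem exists_ne_of_eventually_nhds {P : ℝ → Prop} {a : ℝ} (h : ∀ᶠ b in 𝓝 a, P b) :
    ∃ b, b ≠ a ∧ P b := by
  obtain ⟨b, hb⟩ := ((eventually_nhdsWithin_of_eventually_nhds h).and
    (self_mem_nhdsWithin : {a}ᶜ ∈ 𝓝[≠] a)).exists
  exact ⟨b, hb.2, hb.1⟩

theorem not_becomesLinear_of_injOn {τ : ℝ} (hτ : τ ≠ 0) {U : Set Pt} {Φ : Pt → Pt} (hU : IsOpen U)
    (hΦ : InjOn Φ U) (hne : ∃ S : Stencil, (∀ i, S i ∈ U) ∧ BurgersScheme τ S) :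
    ¬ BecomesLinear (BurgersScheme τ) Φ U := by
  rintro ⟨L, d, hL⟩
  replace hL := hL 0 0
  obtain ⟨S, hSU, hS⟩ := hne
  obtain ⟨x, t, w, K, M, p, q, hp, hq, hM, rfl⟩ := hS.exists_parabola hτ
  -- Four perturbations of one stencil, all equal to it at `ε = 0`. The first slides the left node
  -- along the given parabola.
  have e1 := eventually_parabolaStencil_mem hU (z := (0 : ℝ)) (x := fun _ => x) (t := fun _ => t)
    (w := fun _ => w) (K := fun _ => K) (M := fun _ => M) (p := fun _ => p) (q := fun ε => q + ε)
    (τ := τ) (by fun_prop) (by fun_prop) (by fun_prop) (by fun_prop) (by fun_prop) (by fun_prop)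
    (by fun_prop) (by simpa) (by simpa) (by simpa) (by simpa)
  -- The parabola is tilted by `ε` about the displaced left node, which it thus shares with the
  -- first perturbation; the third one slides back along it to width `q`.
  have e2 := eventually_parabolaStencil_mem hU (z := (0 : ℝ)) (x := fun _ => x) (t := fun _ => t)
    (w := fun ε => w + ε * (q + ε)) (K := fun ε => K + ε) (M := fun _ => M) (p := fun _ => p)
    (q := fun ε => q + ε)
    (τ := τ) (by fun_prop) (by fun_prop) (by fun_prop) (by fun_prop) (by fun_prop) (by fun_prop)
    (by fun_prop) (by simpa) (by simpa) (by simpa) (by simpa)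
  have e3 := eventually_parabolaStencil_mem hU (z := (0 : ℝ)) (x := fun _ => x) (t := fun _ => t)
    (w := fun ε => w + ε * (q + ε)) (K := fun ε => K + ε) (M := fun _ => M) (p := fun _ => p)
    (q := fun _ => q)
    (τ := τ) (by fun_prop) (by fun_prop) (by fun_prop) (by fun_prop) (by fun_prop) (by fun_prop)
    (by fun_prop) (by simpa) (by simpa) (by simpa) (by simpa)
  -- The middle and right nodes are the original ones, and the left node is raised by `ε ^ 2`,
  -- exactly to the left node of the third perturbation.
  have e4 := eventually_parabolaStencil_mem hU (z := (0 : ℝ)) (x := fun _ => x) (t := fun _ => t)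
    (w := fun _ => w) (K := fun ε => K - ε ^ 2 / (q * (p + q)) * p)
    (M := fun ε => M + ε ^ 2 / (q * (p + q))) (p := fun _ => p) (q := fun _ => q)
    (τ := τ) (by fun_prop) (by fun_prop) (by fun_prop) (by fun_prop) (by fun_prop) (by fun_prop)
    (by fun_prop) (by simpa) (by simpa) (by simpa) (by simpa)
  obtain ⟨ε, hε, ⟨-, hq', -, m1⟩, ⟨-, -, -, m2⟩, ⟨-, -, -, m3⟩, ⟨-, -, hM', m4⟩⟩ :=
    exists_ne_of_eventually_nhds (e1.and (e2.and (e3.and e4)))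
  have l0 := hL _ hSU hS
  have l1 := hL _ m1 (burgersScheme_parabolaStencil hτ _ _ _ _ hp hq' hM)
  have l2 := hL _ m2 (burgersScheme_parabolaStencil hτ _ _ _ _ hp hq' hM)
  have l3 := hL _ m3 (burgersScheme_parabolaStencil hτ _ _ _ _ hp hq hM)
  have l4 := hL _ m4 (burgersScheme_parabolaStencil hτ _ _ _ _ hp hq hM')
  have hpq : p + q ≠ 0 := by positivity
  have hq0 := hq.ne'
  have g12 : w + ε * (q + ε) - (K + ε) * (q + ε) + M * (q + ε) ^ 2
      = w - K * (q + ε) + M * (q + ε) ^ 2 := by ring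
  have g34 : w - (K - ε ^ 2 / (q * (p + q)) * p) * q + (M + ε ^ 2 / (q * (p + q))) * q ^ 2
      = w + ε * (q + ε) - (K + ε) * q + M * q ^ 2 := by
    field_simp; ring
  have g04 : w + (K - ε ^ 2 / (q * (p + q)) * p) * p + (M + ε ^ 2 / (q * (p + q))) * p ^ 2
      = w + K * p + M * p ^ 2 := by ring
  -- The original left node contributes as much as that of the first perturbation (same upper,
  -- middle and right nodes), and likewise for the second and third; hence the original one
  -- contributes as much as that of the fourth.
  have hup : Φ (parabolaStencil τ x t w (K - ε ^ 2 / (q * (p + q)) * p)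
      (M + ε ^ 2 / (q * (p + q))) p q .up) = Φ (parabolaStencil τ x t w K M p q .up) := by
    rw [l0, l4]
    simp only [parabolaStencil, linStep, linComb, Prod.ext_iff, Prod.fst_add, Prod.snd_add,
      g12, g34, g04] at l0 l1 l2 l3 ⊢
    obtain ⟨l01, l02, l03⟩ := l0
    obtain ⟨l11, l12, l13⟩ := l1
    obtain ⟨l21, l22, l23⟩ := l2
    obtain ⟨l31, l32, l33⟩ := l3
    refine ⟨by linarith, by linarith, by linarith⟩
  have hx := congrArg Prod.fst (hΦ (m4 .up) (hSU .up) hup)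
  simp only [parabolaStencil] at hx
  have h0 : τ * (ε ^ 2 / (q * (p + q)) * p) = 0 := by linarith
  have : τ * (ε ^ 2 / (q * (p + q)) * p) ≠ 0 := by positivity
  exact this h0

theorem not_isLinearizable_burgersScheme {τ : ℝ} (hτ : τ ≠ 0) :
    ¬ IsLinearizable (BurgersScheme τ) := by
  rintro ⟨U, Φ, ⟨hU, -, hΦ, -⟩, hne, h⟩
  exact not_becomesLinear_of_injOn hτ hU hΦ hne h

/-- The substitution `u = exp (-w / 2)` is continuous and injective, so linearity of the heat scheme
would linearize the Burgers scheme. -/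
theorem not_isLinearScheme_heatScheme {τ : ℝ} (hτ : τ ≠ 0) :
    ¬ IsLinearScheme (HeatScheme τ) := by
  rintro ⟨U, hU, ⟨S, hSU, hpos, hS⟩, L, d, h⟩
  let Φ : Pt → Pt := fun p => (p.1, p.2.1, Real.exp (-p.2.2 / 2))
  have hΦ : Continuous Φ := by fun_prop
  have hinj : Function.Injective Φ := by
    rintro ⟨x, t, w⟩ ⟨x', t', w'⟩ hp
    simp only [Φ, Prod.mk.injEq, Real.exp_eq_exp] at hp ⊢
    exact ⟨hp.1, hp.2.1, by linarith [hp.2.2]⟩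
  refine not_becomesLinear_of_injOn hτ (hU.preimage hΦ) hinj.injOn ⟨_, fun i => ?_, hS⟩
    ⟨L, d, fun m n T hT hBT => h m n (fun i => Φ (T i)) hT ⟨fun i => Real.exp_pos _, ?_⟩⟩
  · have : -(-2 * Real.log (S i).2.2) / 2 = Real.log (S i).2.2 := by ring
    simpa only [mem_preimage, Φ, this, Real.exp_log (hpos i)] using hSU i
  · have : ∀ i, ((T i).1, (T i).2.1, -2 * (-(T i).2.2 / 2)) = T i := fun i =>
      Prod.ext rfl (Prod.ext rfl (by ring))
    simpa only [Φ, Real.log_exp, this] using hBT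

/-! ### Linearization of the equations along a variation -/

/-- The derivative along `v` of the slope at the middle node of the parabola through the three nodes
at the lower time level. -/
noncomputable def slopeVar (K M p q : ℝ) (v : Stencil) : ℝ :=
  (q / p * (v.dwPlus - (K + 2 * M * p) * v.hPlus)
    + p / q * (v.dwMinus - (K - 2 * M * q) * v.hMinus)) / (p + q)

/-- The derivative along `v` of the quadratic coefficient of the parabola through the three nodes
at the lower time level. -/
noncomputable def curvatureVar (K M p q : ℝ) (v : Stencil) : ℝ :=
  ((v.dwPlus - (K + 2 * M * p) * v.hPlus) / p
    - (v.dwMinus - (K - 2 * M * q) * v.hMinus) / q) / (p + q)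

theorem hasDerivAt_const_add_mul_zero (a b : ℝ) : HasDerivAt (fun ε : ℝ => a + ε * b) b 0 := by
  simpa using ((hasDerivAt_id (0 : ℝ)).mul_const b).const_add a

theorem hasLineDerivAt_timeStep (τ x t w K M p q : ℝ) (v : Stencil) :
    HasLineDerivAt ℝ (schemeFun τ .timeStep) v.dt (parabolaStencil τ x t w K M p q) v := by
  refine ((hasDerivAt_const_add_mul_zero τ v.dt).sub_const τ).congr_of_eventuallyEq
    (Eventually.of_forall fun ε => ?_)
  simp only [schemeFun, parabolaStencil, Stencil.dt, Pi.add_apply, Pi.smul_apply, Prod.fst_add,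
    Prod.snd_add, Prod.smul_fst, Prod.smul_snd, smul_eq_mul]
  ring

theorem hasLineDerivAt_rowRight (τ x t w K M p q : ℝ) (v : Stencil) :
    HasLineDerivAt ℝ (schemeFun τ .rowRight) ((v .right).2.1 - (v .mid).2.1)
      (parabolaStencil τ x t w K M p q) v := by
  refine (hasDerivAt_const_add_mul_zero 0 _).congr_of_eventuallyEq
    (Eventually.of_forall fun ε => ?_)
  simp only [schemeFun, parabolaStencil, Pi.add_apply, Pi.smul_apply, Prod.fst_add,
    Prod.snd_add, Prod.smul_fst, Prod.smul_snd, smul_eq_mul]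
  ring

theorem hasLineDerivAt_rowLeft (τ x t w K M p q : ℝ) (v : Stencil) :
    HasLineDerivAt ℝ (schemeFun τ .rowLeft) ((v .left).2.1 - (v .mid).2.1)
      (parabolaStencil τ x t w K M p q) v := by
  refine (hasDerivAt_const_add_mul_zero 0 _).congr_of_eventuallyEq
    (Eventually.of_forall fun ε => ?_)
  simp only [schemeFun, parabolaStencil, Pi.add_apply, Pi.smul_apply, Prod.fst_add,
    Prod.snd_add, Prod.smul_fst, Prod.smul_snd, smul_eq_mul]
  ring

/-- In coordinates centred at the middle node, moving an outer node tangentially to the parabola has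
no first-order effect; hence the slopes `K + 2 * M * p` and `K - 2 * M * q` in `slopeVar`. -/
theorem hasLineDerivAt_mesh {τ p q : ℝ} (hτ : τ ≠ 0) (hp : 0 < p) (hq : 0 < q) (x t w K M : ℝ)
    (v : Stencil) :
    HasLineDerivAt ℝ (schemeFun τ .mesh) ((v.dx - K * v.dt) / τ - slopeVar K M p q v)
      (parabolaStencil τ x t w K M p q) v := by
  have hp' := hp.ne'
  have hq' := hq.ne'
  have hpq : p + q ≠ 0 := by positivity
  have dX := hasDerivAt_const_add_mul_zero (τ * K) v.dx
  have dT := hasDerivAt_const_add_mul_zero τ v.dt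
  have dP := hasDerivAt_const_add_mul_zero p v.hPlus
  have dQ := hasDerivAt_const_add_mul_zero q v.hMinus
  have dA := hasDerivAt_const_add_mul_zero (K * p + M * p ^ 2) v.dwPlus
  have dB := hasDerivAt_const_add_mul_zero (K * q - M * q ^ 2) v.dwMinus
  have h := (dX.div dT (by simpa)).sub (((hasDerivAt_const (0 : ℝ) (1 : ℝ)).div (dP.add dQ)
    (by simpa)).mul (((dQ.div dP (by simpa)).mul dA).add ((dP.div dQ (by simpa)).mul dB)))
  refine (h.congr_deriv ?_).congr_of_eventuallyEq (Eventually.of_forall fun ε => ?_)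
  · simp only [slopeVar, zero_mul, add_zero, Pi.add_apply, Pi.mul_apply, Pi.div_apply]
    field_simp
    ring
  · simp only [schemeFun, parabolaStencil, Stencil.dx, Stencil.dt, Stencil.hPlus, Stencil.hMinus,
      Stencil.dwPlus, Stencil.dwMinus, Pi.add_apply, Pi.smul_apply, Prod.fst_add,
      Prod.snd_add, Prod.smul_fst, Prod.smul_snd, smul_eq_mul, Pi.sub_apply, Pi.mul_apply,
      Pi.div_apply]
    ring_nf

theorem hasLineDerivAt_evolution {τ M p q : ℝ} (hτ : τ ≠ 0) (hp : 0 < p) (hq : 0 < q)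
    (hM : 0 < 1 + 2 * τ * M) (x t w K : ℝ) (v : Stencil) :
    HasLineDerivAt ℝ (schemeFun τ .evolution)
      ((1 + 2 * τ * M) * (v.dwUp - K * v.dx + K ^ 2 / 2 * v.dt)
        - (2 * M * v.dt + 2 * τ * curvatureVar K M p q v))
      (parabolaStencil τ x t w K M p q) v := by
  have hp' := hp.ne'
  have hq' := hq.ne'
  have hpq : p + q ≠ 0 := by positivity
  have dX := hasDerivAt_const_add_mul_zero (τ * K) v.dx
  have dT := hasDerivAt_const_add_mul_zero τ v.dt
  have dW := hasDerivAt_const_add_mul_zero (τ * K ^ 2 / 2 + Real.log (1 + 2 * τ * M)) v.dwUp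
  have dP := hasDerivAt_const_add_mul_zero p v.hPlus
  have dQ := hasDerivAt_const_add_mul_zero q v.hMinus
  have dA := hasDerivAt_const_add_mul_zero (K * p + M * p ^ 2) v.dwPlus
  have dB := hasDerivAt_const_add_mul_zero (K * q - M * q ^ 2) v.dwMinus
  have h := ((dW.sub ((dX.pow 2).div (dT.const_mul 2) (by simpa))).exp).sub
    ((((dT.const_mul 2).div (dP.add dQ) (by simpa)).mul
      ((dA.div dP (by simpa)).sub (dB.div dQ (by simpa)))).const_add 1)
  refine (h.congr_deriv ?_).congr_of_eventuallyEq (Eventually.of_forall fun ε => ?_)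
  · have h1 : τ * K ^ 2 / 2 + Real.log (1 + 2 * τ * M) - (τ * K) ^ 2 / (2 * τ)
        = Real.log (1 + 2 * τ * M) := by
      field_simp
      ring
    simp only [curvatureVar, zero_mul, add_zero, Pi.add_apply, Pi.div_apply, Pi.sub_apply,
      Pi.pow_apply, h1, Real.exp_log hM]
    field_simp
    ring
  · simp only [schemeFun, parabolaStencil, Stencil.dx, Stencil.dt, Stencil.hPlus, Stencil.hMinus,
      Stencil.dwPlus, Stencil.dwMinus, Stencil.dwUp, Pi.add_apply, Pi.smul_apply, Prod.fst_add,
      Prod.snd_add, Prod.smul_fst, Prod.smul_snd, smul_eq_mul, Pi.sub_apply, Pi.mul_apply,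
      Pi.div_apply, Pi.pow_apply]
    ring_nf

/-! ### Local consequences of invariance -/

/-- The solution of the linear scheme on one stencil with given values at the lower nodes. -/
def linExtend (L : LinearCoeffs) (l c r : Pt) : Stencil
  | .left => l
  | .mid => c
  | .right => r
  | .up => linStep L fun
    | .left => l
    | .mid => c
    | .right => r
    | .up => 0

theorem linExtend_up (L : LinearCoeffs) (l c r : Pt) :
    linExtend L l c r .up = linStep L (linExtend L l c r) := rfl

theorem IsSymmetryOn.mono {τ : ℝ} {U : Set Pt} {A A' : Set SchemeEq} {D D' : Stencil → Prop}
    {L : ℤ → ℤ → LinearCoeffs} {X : Generator} (h : IsSymmetryOn τ U A D L X) (hA : A' ⊆ A)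
    (hD : ∀ σ, D' σ → D σ) : IsSymmetryOn τ U A' D' L X :=
  fun m n S σ hSU hS hσ hDσ a ha => h m n S σ hSU hS hσ (hD σ hDσ) a (hA ha)

section

variable {τ : ℝ} {U : Set Pt} {A : Set SchemeEq} {D : Stencil → Prop}
  {L : ℤ → ℤ → LinearCoeffs} {X : Generator} {x t w K M p q : ℝ}

theorem IsSymmetryOn.step_equations (hτ : τ ≠ 0) (h : IsSymmetryOn τ U stepEqs D L X) (hp : 0 < p)
    (hq : 0 < q) (hM : 0 < 1 + 2 * τ * M) (hU : ∀ i, parabolaStencil τ x t w K M p q i ∈ U)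
    (m n : ℤ) {σ : Stencil} (hσ : σ .up = linStep (L m n) σ) (hD : D σ) :
    (X.prolong (parabolaStencil τ x t w K M p q) σ).dt = 0 ∧
    (X.prolong (parabolaStencil τ x t w K M p q) σ).dx =
      τ * slopeVar K M p q (X.prolong (parabolaStencil τ x t w K M p q) σ) ∧
    (1 + 2 * τ * M) * ((X.prolong (parabolaStencil τ x t w K M p q) σ).dwUp
        - K * (X.prolong (parabolaStencil τ x t w K M p q) σ).dx) =
      2 * τ * curvatureVar K M p q (X.prolong (parabolaStencil τ x t w K M p q) σ) := by
  have hs := h m n _ σ hU (burgersScheme_parabolaStencil hτ x t w K hp hq hM) hσ hD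
  have h1 := HasDerivAt.unique (hasLineDerivAt_timeStep τ x t w K M p q _)
    (hs .timeStep (by simp [stepEqs]))
  have h2 := HasDerivAt.unique (hasLineDerivAt_mesh hτ hp hq x t w K M _)
    (hs .mesh (by simp [stepEqs]))
  have h3 := HasDerivAt.unique (hasLineDerivAt_evolution hτ hp hq hM x t w K _)
    (hs .evolution (by simp [stepEqs]))
  rw [h1] at h2 h3
  refine ⟨h1, ?_, by linarith⟩
  rw [mul_zero, sub_zero, sub_eq_zero, div_eq_iff hτ] at h2
  linarith

/-- For `σ` supported at the lower right node, `slopeVar` is a multiple of the left-hand side by a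
factor depending on `q`, whereas the variation at the upper node does not depend on `q`. -/
theorem IsSymmetryOn.right_relation (hτ : τ ≠ 0) (hUo : IsOpen U)
    (h : IsSymmetryOn τ U stepEqs RowConstant L X) (hp : 0 < p) (hq : 0 < q)
    (hM : 0 < 1 + 2 * τ * M) (hU : ∀ i, parabolaStencil τ x t w K M p q i ∈ U) (y u : ℝ) :
    X.ψ (parabolaStencil τ x t w K M p q .right) * u
      - (K + 2 * M * p) * (X.ξ (parabolaStencil τ x t w K M p q .right) * y) = 0 := by
  have e := eventually_parabolaStencil_mem hUo (z := q) (x := fun _ => x) (t := fun _ => t)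
    (w := fun _ => w) (K := fun _ => K) (M := fun _ => M) (p := fun _ => p) (q := fun q => q)
    (τ := τ) (by fun_prop) (by fun_prop) (by fun_prop) (by fun_prop) (by fun_prop) (by fun_prop)
    (by fun_prop) hp hq hM hU
  obtain ⟨q', hne, -, hq', -, hU'⟩ := exists_ne_of_eventually_nhds e
  have hσ := linExtend_up (L 0 0) 0 0 (y, 0, u)
  have hD : RowConstant (linExtend (L 0 0) 0 0 (y, 0, u)) := ⟨rfl, rfl⟩
  have h1 := (h.step_equations hτ hp hq hM hU 0 0 hσ hD).2.1
  have h2 := (h.step_equations hτ hp hq' hM hU' 0 0 hσ hD).2.1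
  simp only [slopeVar, Stencil.dx, Stencil.dwPlus, Stencil.dwMinus, Stencil.hPlus,
    Stencil.hMinus, Generator.prolong, parabolaStencil, linExtend, Prod.fst_zero, Prod.snd_zero,
    mul_zero, sub_zero, add_zero] at h1 h2 ⊢
  rw [h1] at h2
  set c := X.ψ (x + p, t, w + K * p + M * p ^ 2) * u
    - (K + 2 * M * p) * (X.ξ (x + p, t, w + K * p + M * p ^ 2) * y) with hc
  field_simp at h2
  have : c * (p * (q - q')) = 0 := by linarith
  simpa [hp.ne', sub_eq_zero, hne.symm] using this

theorem IsSymmetryOn.left_relation (hτ : τ ≠ 0) (hUo : IsOpen U)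
    (h : IsSymmetryOn τ U stepEqs RowConstant L X) (hp : 0 < p) (hq : 0 < q)
    (hM : 0 < 1 + 2 * τ * M) (hU : ∀ i, parabolaStencil τ x t w K M p q i ∈ U) (y u : ℝ) :
    X.ψ (parabolaStencil τ x t w K M p q .left) * u
      - (K - 2 * M * q) * (X.ξ (parabolaStencil τ x t w K M p q .left) * y) = 0 := by
  have e := eventually_parabolaStencil_mem hUo (z := p) (x := fun _ => x) (t := fun _ => t)
    (w := fun _ => w) (K := fun _ => K) (M := fun _ => M) (p := fun p => p) (q := fun _ => q)
    (τ := τ) (by fun_prop) (by fun_prop) (by fun_prop) (by fun_prop) (by fun_prop) (by fun_prop)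
    (by fun_prop) hp hq hM hU
  obtain ⟨p', hne, hp', -, -, hU'⟩ := exists_ne_of_eventually_nhds e
  have hσ := linExtend_up (L 0 0) (y, 0, u) 0 0
  have hD : RowConstant (linExtend (L 0 0) (y, 0, u) 0 0) := ⟨rfl, rfl⟩
  have h1 := (h.step_equations hτ hp hq hM hU 0 0 hσ hD).2.1
  have h2 := (h.step_equations hτ hp' hq hM hU' 0 0 hσ hD).2.1
  simp only [slopeVar, Stencil.dx, Stencil.dwPlus, Stencil.dwMinus, Stencil.hPlus,
    Stencil.hMinus, Generator.prolong, parabolaStencil, linExtend, Prod.fst_zero, Prod.snd_zero,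
    mul_zero, sub_zero, zero_add, zero_sub, mul_neg, sub_neg_eq_add] at h1 h2 ⊢
  rw [h1] at h2
  set c := X.ψ (x - q, t, w - K * q + M * q ^ 2) * u
    - (K - 2 * M * q) * (X.ξ (x - q, t, w - K * q + M * q ^ 2) * y) with hc
  rw [show ∀ a b : ℝ, -a + b = -(a - b) by intros; ring, ← hc] at h2
  field_simp at h2
  have : c * (q * (p - p')) = 0 := by linarith
  simpa [hq.ne', sub_eq_zero, hne.symm] using this

/-- Moving the middle node along the parabola changes the slope there by `2 * M * b`. This is
independent of `p` and cancels between two widths, leaving the part transverse to the parabola. -/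
theorem IsSymmetryOn.mid_relation (hτ : τ ≠ 0) (hUo : IsOpen U)
    (h : IsSymmetryOn τ U stepEqs RowConstant L X) (hp : 0 < p) (hq : 0 < q)
    (hM : 0 < 1 + 2 * τ * M) (hU : ∀ i, parabolaStencil τ x t w K M p q i ∈ U) (y u : ℝ) :
    X.ψ (parabolaStencil τ x t w K M p q .mid) * u
      - K * (X.ξ (parabolaStencil τ x t w K M p q .mid) * y) = 0 := by
  have e := eventually_parabolaStencil_mem hUo (z := p) (x := fun _ => x) (t := fun _ => t)
    (w := fun _ => w) (K := fun _ => K) (M := fun _ => M) (p := fun p => p) (q := fun _ => q)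
    (τ := τ) (by fun_prop) (by fun_prop) (by fun_prop) (by fun_prop) (by fun_prop) (by fun_prop)
    (by fun_prop) hp hq hM hU
  obtain ⟨p', hne, hp', -, -, hU'⟩ := exists_ne_of_eventually_nhds e
  have hσ := linExtend_up (L 0 0) 0 (y, 0, u) 0
  have hD : RowConstant (linExtend (L 0 0) 0 (y, 0, u) 0) := ⟨rfl, rfl⟩
  have h1 := (h.step_equations hτ hp hq hM hU 0 0 hσ hD).2.1
  have h2 := (h.step_equations hτ hp' hq hM hU' 0 0 hσ hD).2.1
  simp only [slopeVar, Stencil.dx, Stencil.dwPlus, Stencil.dwMinus, Stencil.hPlus,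
    Stencil.hMinus, Generator.prolong, parabolaStencil, linExtend, Prod.fst_zero, Prod.snd_zero,
    mul_zero, sub_zero, zero_sub] at h1 h2 ⊢
  rw [h1] at h2
  set a := X.ψ (x, t, w) * u
  set b := X.ξ (x, t, w) * y
  have key : ∀ r, 0 < r → (q / r * (-a - (K + 2 * M * r) * -b)
      + r / q * (a - (K - 2 * M * q) * b)) / (r + q) = (a - K * b) * (1 / q - 1 / r)
        + 2 * M * b := by
    intro r hr
    have : r + q ≠ 0 := by positivity
    field_simp
    ring
  rw [key p hp, key p' hp'] at h2
  have h3 : (a - K * b) * (1 / p' - 1 / p) = 0 := by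
    have := mul_left_cancel₀ hτ h2
    linarith
  refine (mul_eq_zero.1 h3).resolve_right (sub_ne_zero.2 fun h4 => hne ?_)
  simpa using h4

theorem IsSymmetryOn.lower_eq_zero (hτ : τ ≠ 0) (hUo : IsOpen U)
    (h : IsSymmetryOn τ U stepEqs RowConstant L X) {S : Stencil} (hU : ∀ i, S i ∈ U)
    (hS : BurgersScheme τ S) {i : Node} (hi : i ≠ .up) : X.ξ (S i) = 0 ∧ X.ψ (S i) = 0 := by
  obtain ⟨x, t, w, K, M, p, q, hp, hq, hM, rfl⟩ := hS.exists_parabola hτ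
  rcases i with _ | _ | _ | _
  · refine ⟨?_, by simpa using h.left_relation hτ hUo hp hq hM hU 0 1⟩
    -- Tilting the parabola about the left node keeps this node and changes the slope there.
    have e := eventually_parabolaStencil_mem hUo (z := (0 : ℝ)) (x := fun _ => x)
      (t := fun _ => t) (w := fun ε => w + ε * q) (K := fun ε => K + ε) (M := fun _ => M)
      (p := fun _ => p) (q := fun _ => q) (τ := τ) (by fun_prop) (by fun_prop) (by fun_prop)
      (by fun_prop) (by fun_prop) (by fun_prop) (by fun_prop) hp hq hM (by simpa)
    obtain ⟨ε, hε, -, -, -, hU'⟩ := exists_ne_of_eventually_nhds e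
    have h1 := h.left_relation hτ hUo hp hq hM hU 1 0
    have h2 := h.left_relation hτ hUo hp hq hM hU' 1 0
    simp only [parabolaStencil] at h1 h2 ⊢
    rw [show w + ε * q - (K + ε) * q + M * q ^ 2 = w - K * q + M * q ^ 2 by ring] at h2
    refine (mul_eq_zero.1 (?_ : ε * _ = 0)).resolve_left hε
    linarith
  · refine ⟨?_, by simpa using h.mid_relation hτ hUo hp hq hM hU 0 1⟩
    have e := eventually_parabolaStencil_mem hUo (z := (0 : ℝ)) (x := fun _ => x)
      (t := fun _ => t) (w := fun _ => w) (K := fun ε => K + ε) (M := fun _ => M)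
      (p := fun _ => p) (q := fun _ => q) (τ := τ) (by fun_prop) (by fun_prop) (by fun_prop)
      (by fun_prop) (by fun_prop) (by fun_prop) (by fun_prop) hp hq hM (by simpa)
    obtain ⟨ε, hε, -, -, -, hU'⟩ := exists_ne_of_eventually_nhds e
    have h1 := h.mid_relation hτ hUo hp hq hM hU 1 0
    have h2 := h.mid_relation hτ hUo hp hq hM hU' 1 0
    simp only [parabolaStencil] at h1 h2 ⊢
    refine (mul_eq_zero.1 (?_ : ε * _ = 0)).resolve_left hε
    linarith
  · refine ⟨?_, by simpa using h.right_relation hτ hUo hp hq hM hU 0 1⟩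
    have e := eventually_parabolaStencil_mem hUo (z := (0 : ℝ)) (x := fun _ => x)
      (t := fun _ => t) (w := fun ε => w - ε * p) (K := fun ε => K + ε) (M := fun _ => M)
      (p := fun _ => p) (q := fun _ => q) (τ := τ) (by fun_prop) (by fun_prop) (by fun_prop)
      (by fun_prop) (by fun_prop) (by fun_prop) (by fun_prop) hp hq hM (by simpa)
    obtain ⟨ε, hε, -, -, -, hU'⟩ := exists_ne_of_eventually_nhds e
    have h1 := h.right_relation hτ hUo hp hq hM hU 1 0
    have h2 := h.right_relation hτ hUo hp hq hM hU' 1 0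
    simp only [parabolaStencil] at h1 h2 ⊢
    rw [show w - ε * p + (K + ε) * p + M * p ^ 2 = w + K * p + M * p ^ 2 by ring] at h2
    refine (mul_eq_zero.1 (?_ : ε * _ = 0)).resolve_left hε
    linarith
  · exact absurd rfl hi

theorem IsSymmetryOn.prolong_eq_zero (hτ : τ ≠ 0) (hUo : IsOpen U)
    (h : IsSymmetryOn τ U stepEqs RowConstant L X) {S : Stencil} (hU : ∀ i, S i ∈ U)
    (hS : BurgersScheme τ S) {m n : ℤ} {σ : Stencil} (hσ : σ .up = linStep (L m n) σ)
    (hD : RowConstant σ) (i : Node) :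
    (X.prolong S σ i).1 = 0 ∧ (X.prolong S σ i).2.2 = 0 := by
  by_cases hi : i = .up
  · subst hi
    have hl := h.lower_eq_zero hτ hUo hU hS (i := .left) (by simp)
    have hc := h.lower_eq_zero hτ hUo hU hS (i := .mid) (by simp)
    have hr := h.lower_eq_zero hτ hUo hU hS (i := .right) (by simp)
    obtain ⟨x, t, w, K, M, p, q, hp, hq, hM, rfl⟩ := hS.exists_parabola hτ
    obtain ⟨-, h1, h2⟩ := h.step_equations hτ hp hq hM hU m n hσ hD
    simp only [slopeVar, curvatureVar, Stencil.dx, Stencil.dwPlus, Stencil.dwMinus, Stencil.hPlus,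
      Stencil.hMinus, Stencil.dwUp, Generator.prolong, hl, hc, hr, zero_mul, mul_zero, sub_zero,
      add_zero, zero_div] at h1 h2 ⊢
    refine ⟨h1, ?_⟩
    rw [h1, mul_zero, sub_zero] at h2
    exact (mul_eq_zero.1 h2).resolve_left hM.ne'
  · simp [Generator.prolong, h.lower_eq_zero hτ hUo hU hS hi]

theorem IsSymmetryOn.phi_up_mul (hτ : τ ≠ 0) (h : IsSymmetryOn τ U stepEqs D L X) {S : Stencil}
    (hU : ∀ i, S i ∈ U) (hS : BurgersScheme τ S) {m n : ℤ} {σ : Stencil}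
    (hσ : σ .up = linStep (L m n) σ) (hD : D σ) :
    X.φ (S .up) * linComb (L m n).b σ = X.φ (S .mid) * (σ .mid).2.1 := by
  obtain ⟨x, t, w, K, M, p, q, hp, hq, hM, rfl⟩ := hS.exists_parabola hτ
  have h1 := (h.step_equations hτ hp hq hM hU m n hσ hD).1
  simp only [Stencil.dt, Generator.prolong, hσ, linStep] at h1
  linarith

/-- Nearby middle nodes at the same time can be joined to the same upper node, and each value of `φ`
there is the same multiple of its value at that upper node. -/
theorem IsSymmetryOn.phi_locally_constant (hτ : τ ≠ 0) (hUo : IsOpen U)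
    (h : IsSymmetryOn τ U stepEqs RowConstant L X) {S : Stencil} (hU : ∀ i, S i ∈ U)
    (hS : BurgersScheme τ S) :
    ∀ᶠ r in 𝓝 (S .mid), r.2.1 = (S .mid).2.1 → X.φ r = X.φ (S .mid) := by
  have hσ := linExtend_up (L 0 0) (0, 1, 0) (0, 1, 0) (0, 1, 0)
  have hD : RowConstant (linExtend (L 0 0) (0, 1, 0) (0, 1, 0) (0, 1, 0)) := ⟨rfl, rfl⟩
  have h0 := h.phi_up_mul hτ hU hS hσ hD
  obtain ⟨x, t, w, K, M, p, q, hp, hq, hM, rfl⟩ := hS.exists_parabola hτ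
  let W : ℝ := w + τ * K ^ 2 / 2 + Real.log (1 + 2 * τ * M)
  -- `k r` and `c r` are the slope and quadratic coefficient that send the middle node `r` to the
  -- given upper node.
  let k : Pt → ℝ := fun r => (x + τ * K - r.1) / τ
  let c : Pt → ℝ := fun r => (Real.exp (W - r.2.2 - τ * k r ^ 2 / 2) - 1) / (2 * τ)
  have hk0 : k (x, t, w) = K := by simp only [k]; field_simp; ring
  have hc : ∀ r, 1 + 2 * τ * c r = Real.exp (W - r.2.2 - τ * k r ^ 2 / 2) := by
    intro r; simp only [c]; field_simp; ring
  have hc0 : c (x, t, w) = M := by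
    have h1 := hc (x, t, w)
    rw [hk0, show W - w - τ * K ^ 2 / 2 = Real.log (1 + 2 * τ * M) by simp only [W]; ring,
      Real.exp_log hM] at h1
    exact mul_left_cancel₀ (mul_ne_zero two_ne_zero hτ) (by linarith)
  have hk : Continuous k := by fun_prop
  have hcc : Continuous c := by fun_prop
  have e := eventually_parabolaStencil_mem hUo (z := ((x, t, w) : Pt)) (x := fun r => r.1)
    (t := fun _ => t) (w := fun r => r.2.2) (K := k) (M := c) (p := fun _ => p) (q := fun _ => q)
    (τ := τ) (by fun_prop) (by fun_prop) (by fun_prop) hk.continuousAt hcc.continuousAt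
    (by fun_prop) (by fun_prop) hp hq (by rwa [hc0]) (by rwa [hk0, hc0])
  filter_upwards [e] with r hr hrt
  obtain ⟨-, -, hM', hU'⟩ := hr
  have h1 := h.phi_up_mul hτ hU' (burgersScheme_parabolaStencil hτ _ _ _ _ hp hq hM') hσ hD
  have hup : parabolaStencil τ r.1 t r.2.2 (k r) (c r) p q .up
      = parabolaStencil τ x t w K M p q .up := by
    simp only [parabolaStencil, hc, Real.log_exp, Prod.mk.injEq, true_and]
    refine ⟨?_, by simp only [W]; ring⟩
    simp only [k]; field_simp; ring
  rw [hup, h0] at h1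
  have hmid : parabolaStencil τ r.1 t r.2.2 (k r) (c r) p q .mid = r :=
    Prod.ext rfl (Prod.ext hrt.symm rfl)
  rw [hmid] at h1
  simpa [linExtend] using h1.symm

end

/-! ### Classification of generators on the whole space -/

theorem exists_burgersScheme_mid_up {τ : ℝ} (hτ : τ ≠ 0) (x t w x' w' : ℝ) :
    ∃ S, BurgersScheme τ S ∧ S .mid = (x, t, w) ∧ S .up = (x', t + τ, w') := by
  have hM : 1 + 2 * τ * ((Real.exp (w' - w - τ * ((x' - x) / τ) ^ 2 / 2) - 1) / (2 * τ))
      = Real.exp (w' - w - τ * ((x' - x) / τ) ^ 2 / 2) := by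
    field_simp; ring
  refine ⟨_, burgersScheme_parabolaStencil hτ x t w ((x' - x) / τ) one_pos one_pos
    (hM ▸ Real.exp_pos _), rfl, ?_⟩
  simp only [parabolaStencil, hM, Real.log_exp, Prod.mk.injEq, true_and]
  constructor
  · field_simp; ring
  · ring

section

variable {τ : ℝ} {A : Set SchemeEq} {D : Stencil → Prop} {L : ℤ → ℤ → LinearCoeffs}
  {X : Generator}

theorem IsSymmetryOn.xi_psi_eq_zero (hτ : τ ≠ 0)
    (h : IsSymmetryOn τ univ stepEqs RowConstant L X) : X.ξ = 0 ∧ X.ψ = 0 := by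
  have key : ∀ r, X.ξ r = 0 ∧ X.ψ r = 0 := by
    rintro ⟨x, t, w⟩
    obtain ⟨S, hS, hmid, -⟩ := exists_burgersScheme_mid_up hτ x t w x w
    exact hmid ▸ h.lower_eq_zero hτ isOpen_univ (fun _ => mem_univ _) hS (i := .mid) (by simp)
  exact ⟨funext fun r => (key r).1, funext fun r => (key r).2⟩

theorem zpow_quasiperiodic {β τ : ℝ} (hβ : β ≠ 0) {f : ℝ → ℝ} (hf : ∀ t, f t = β * f (t + τ))
    (t : ℝ) (k : ℤ) : f (t + k * τ) = β ^ (-k) * f t := by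
  induction k using Int.induction_on generalizing t with
  | zero => simp
  | succ k ih =>
    have h1 := hf (t + k * τ)
    rw [show t + k * τ + τ = t + ((k : ℤ) + 1 : ℤ) * τ by push_cast; ring] at h1
    have h2 := ih t
    rw [Int.cast_natCast] at h2
    rw [h2] at h1
    rw [neg_add, zpow_add₀ hβ, zpow_neg_one]
    field_simp
    linarith
  | pred k ih =>
    have h1 := hf (t + ((-k - 1 : ℤ) : ℝ) * τ)
    rw [show t + ((-k - 1 : ℤ) : ℝ) * τ + τ = t + ((-k : ℤ) : ℝ) * τ by push_cast; ring, ih t] at h1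
    rw [h1, neg_sub, sub_neg_eq_add, neg_neg, zpow_add₀ hβ, zpow_one]
    ring

theorem IsSymmetryOn.phi_classification (hτ : τ ≠ 0) (h : IsSymmetryOn τ univ stepEqs D L X)
    (hD : ∀ σ, RowConstant σ → D σ) :
    X.φ = 0 ∨ ∃ (β : ℝ) (φ₀ : ℝ → ℝ), β ≠ 0 ∧ (∀ p, X.φ p = φ₀ p.2.1) ∧
      (∀ (t : ℝ) (k : ℤ), φ₀ (t + k * τ) = β ^ (-k) * φ₀ t) ∧
      ∀ (m n : ℤ) (σ : Stencil), σ .up = linStep (L m n) σ → D σ →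
        linComb (L m n).b σ = β * (σ .mid).2.1 := by
  by_cases hφ : X.φ = 0
  · exact Or.inl hφ
  right
  obtain ⟨⟨x₀, t₀, w₀⟩, hr⟩ := Function.ne_iff.1 hφ
  have step : ∀ (x t w x' w' : ℝ) (m n : ℤ) (σ : Stencil), σ .up = linStep (L m n) σ → D σ →
      X.φ (x', t + τ, w') * linComb (L m n).b σ = X.φ (x, t, w) * (σ .mid).2.1 := by
    intro x t w x' w' m n σ hσ hDσ
    obtain ⟨S, hS, hmid, hup⟩ := exists_burgersScheme_mid_up hτ x t w x' w'
    rw [← hmid, ← hup]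
    exact h.phi_up_mul hτ (fun _ => mem_univ _) hS hσ hDσ
  -- With `s = 1` on the lower row at index `(0, 0)`, `β` is the sum of the coefficients of `s`;
  -- comparison with this one stencil fixes the equation for `s` at all indices.
  set σ₁ := linExtend (L 0 0) (0, 1, 0) (0, 1, 0) (0, 1, 0)
  set β := linComb (L 0 0).b σ₁
  have h1 : ∀ x t w x' w' : ℝ, X.φ (x', t + τ, w') * β = X.φ (x, t, w) := by
    intro x t w x' w'
    have := step x t w x' w' 0 0 σ₁ (linExtend_up _ _ _ _) (hD _ ⟨rfl, rfl⟩)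
    rw [this]
    simp [σ₁, linExtend]
  have hne : X.φ (0, t₀ + τ, 0) ≠ 0 ∧ β ≠ 0 := by
    rw [← mul_ne_zero_iff, h1 x₀ t₀ w₀]
    exact hr
  refine ⟨β, fun t => X.φ (0, t, 0), hne.2, ?_, zpow_quasiperiodic (f := fun t => X.φ (0, t, 0)) hne.2 ?_, ?_⟩
  · rintro ⟨x, t, w⟩
    exact (h1 x t w 0 0).symm.trans (h1 0 t 0 0 0)
  · intro t
    exact (h1 0 t 0 0 0).symm.trans (mul_comm _ _)
  · intro m n σ hσ hDσ
    have h2 := step x₀ t₀ w₀ 0 0 m n σ hσ hDσ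
    rw [← h1 x₀ t₀ w₀ 0 0, mul_assoc] at h2
    exact mul_left_cancel₀ hne.1 h2

/-- Once `ξ = ψ = 0` and the time step is unvaried, the derivatives of the mesh and evolution
equations vanish identically, so only conditions on `φ s` remain. -/
theorem isSymmetryOn_of_phi_relations {U : Set Pt} (hτ : τ ≠ 0) (hξ : X.ξ = 0) (hψ : X.ψ = 0)
    (hup : ∀ (m n : ℤ) (S σ : Stencil), BurgersScheme τ S → σ .up = linStep (L m n) σ → D σ →
      X.φ (S .up) * (σ .up).2.1 = X.φ (S .mid) * (σ .mid).2.1)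
    (hright : .rowRight ∈ A → ∀ S σ : Stencil, BurgersScheme τ S → D σ →
      X.φ (S .right) * (σ .right).2.1 = X.φ (S .mid) * (σ .mid).2.1)
    (hleft : .rowLeft ∈ A → ∀ S σ : Stencil, BurgersScheme τ S → D σ →
      X.φ (S .left) * (σ .left).2.1 = X.φ (S .mid) * (σ .mid).2.1) :
    IsSymmetryOn τ U A D L X := by
  intro m n S σ _ hS hσ hDσ a ha
  have hu := hup m n S σ hS hσ hDσ
  have hr := fun ha => hright ha S σ hS hDσ
  have hl := fun ha => hleft ha S σ hS hDσ
  obtain ⟨x, t, w, K, M, p, q, hp, hq, hM, rfl⟩ := hS.exists_parabola hτ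
  set v := X.prolong (parabolaStencil τ x t w K M p q) σ with hv
  have hdt : v.dt = 0 := sub_eq_zero.2 hu
  have hx : ∀ i, (v i).1 = 0 := fun i => by simp [hv, Generator.prolong, hξ]
  have hw : ∀ i, (v i).2.2 = 0 := fun i => by simp [hv, Generator.prolong, hψ]
  rcases a with _ | _ | _ | _ | _
  · refine (hasLineDerivAt_mesh hτ hp hq x t w K M v).congr_deriv ?_
    simp [hdt, slopeVar, Stencil.dx, Stencil.dwPlus, Stencil.dwMinus, Stencil.hPlus,
      Stencil.hMinus, hx, hw]
  · refine (hasLineDerivAt_evolution hτ hp hq hM x t w K v).congr_deriv ?_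
    simp [hdt, curvatureVar, Stencil.dx, Stencil.dwUp, Stencil.dwPlus, Stencil.dwMinus,
      Stencil.hPlus, Stencil.hMinus, hx, hw]
  · exact (hasLineDerivAt_timeStep τ x t w K M p q v).congr_deriv hdt
  · exact (hasLineDerivAt_rowRight τ x t w K M p q v).congr_deriv (sub_eq_zero.2 (hr ha))
  · exact (hasLineDerivAt_rowLeft τ x t w K M p q v).congr_deriv (sub_eq_zero.2 (hl ha))

theorem BurgersScheme.time_up {S : Stencil} (hS : BurgersScheme τ S) :
    (S .up).2.1 = (S .mid).2.1 + τ := by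
  have h : (S .up).2.1 - (S .mid).2.1 - τ = 0 := hS.2.2 .timeStep
  linarith

theorem BurgersScheme.time_right {S : Stencil} (hS : BurgersScheme τ S) :
    (S .right).2.1 = (S .mid).2.1 := sub_eq_zero.1 (hS.2.2 .rowRight)

theorem BurgersScheme.time_left {S : Stencil} (hS : BurgersScheme τ S) :
    (S .left).2.1 = (S .mid).2.1 := sub_eq_zero.1 (hS.2.2 .rowLeft)

theorem phi_up_mul_of_quasiperiodic {β : ℝ} {φ₀ : ℝ → ℝ} (hβ : β ≠ 0)
    (hφ : ∀ p, X.φ p = φ₀ p.2.1) (hper : ∀ (t : ℝ) (k : ℤ), φ₀ (t + k * τ) = β ^ (-k) * φ₀ t)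
    {S σ : Stencil} {m n : ℤ} (hS : BurgersScheme τ S) (hσ : σ .up = linStep (L m n) σ)
    (hb : linComb (L m n).b σ = β * (σ .mid).2.1) :
    X.φ (S .up) * (σ .up).2.1 = X.φ (S .mid) * (σ .mid).2.1 := by
  have h1 := hper (S .mid).2.1 1
  rw [Int.cast_one, one_mul, zpow_neg_one] at h1
  rw [hφ, hφ, hS.time_up, h1, hσ, linStep, hb]
  field_simp

theorem isSymmetryOn_stepEqs_allSolutions_iff (hτ : τ ≠ 0) :
    IsSymmetryOn τ univ stepEqs AllSolutions L X ↔
      X.ξ = 0 ∧ X.ψ = 0 ∧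
        (X.φ = 0 ∨ ∃ (β : ℝ) (φ₀ : ℝ → ℝ), β ≠ 0 ∧ (∀ p, X.φ p = φ₀ p.2.1) ∧
          (∀ (t : ℝ) (k : ℤ), φ₀ (t + k * τ) = β ^ (-k) * φ₀ t) ∧
          ∀ m n j, (L m n).b j = if j = 6 then β else 0) := by
  constructor
  · intro h
    obtain ⟨hξ, hψ⟩ :=
      IsSymmetryOn.xi_psi_eq_zero hτ (h.mono Subset.rfl fun _ _ => trivial)
    refine ⟨hξ, hψ, (h.phi_classification hτ fun _ _ => trivial).imp_right ?_⟩
    rintro ⟨β, φ₀, hβ, hφ, hper, hb⟩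
    refine ⟨β, φ₀, hβ, hφ, hper, fun m n j => ?_⟩
    -- Solutions supported at one node in one variable isolate the nine coefficients.
    have hb' := fun l c r => hb m n (linExtend (L m n) l c r) rfl trivial
    simp only [linComb, linExtend] at hb'
    fin_cases j
    · simpa using hb' 0 (0, 0, 1) 0
    · simpa using hb' (0, 0, 1) 0 0
    · simpa using hb' 0 0 (0, 0, 1)
    · simpa using hb' 0 (1, 0, 0) 0
    · simpa using hb' (1, 0, 0) 0 0
    · simpa using hb' 0 0 (1, 0, 0)
    · simpa using hb' 0 (0, 1, 0) 0
    · simpa using hb' (0, 1, 0) 0 0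
    · simpa using hb' 0 0 (0, 1, 0)
  · rintro ⟨hξ, hψ, h⟩
    refine isSymmetryOn_of_phi_relations hτ hξ hψ (fun m n S σ hS hσ _ => ?_)
      (by simp [stepEqs]) (by simp [stepEqs])
    rcases h with h | ⟨β, φ₀, hβ, hφ, hper, hb⟩
    · simp [h]
    · exact phi_up_mul_of_quasiperiodic hβ hφ hper hS hσ (by simp [linComb, hb, Fin.ext_iff])

theorem isSymmetryOn_univ_rowConstant_iff (hτ : τ ≠ 0) :
    IsSymmetryOn τ univ univ RowConstant L X ↔
      X.ξ = 0 ∧ X.ψ = 0 ∧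
        (X.φ = 0 ∨ ∃ (β : ℝ) (φ₀ : ℝ → ℝ), β ≠ 0 ∧ (∀ p, X.φ p = φ₀ p.2.1) ∧
          (∀ (t : ℝ) (k : ℤ), φ₀ (t + k * τ) = β ^ (-k) * φ₀ t) ∧
          ∀ m n, (∀ j, j < 6 → (L m n).b j = 0) ∧
            (L m n).b 6 + (L m n).b 7 + (L m n).b 8 = β) := by
  constructor
  · intro h'
    have h := h'.mono (subset_univ stepEqs) fun _ => id
    obtain ⟨hξ, hψ⟩ := h.xi_psi_eq_zero hτ
    refine ⟨hξ, hψ, (h.phi_classification hτ fun _ => id).imp_right ?_⟩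
    rintro ⟨β, φ₀, hβ, hφ, hper, hb⟩
    refine ⟨β, φ₀, hβ, hφ, hper, fun m n => ?_⟩
    -- Row-constancy leaves `y` and `u` free at each node but allows only one value of `s`, so only
    -- the sum of the last three coefficients is determined.
    have hb' := fun y₁ y₂ y₃ u₁ u₂ u₃ s => hb m n
      (linExtend (L m n) (y₁, s, u₁) (y₂, s, u₂) (y₃, s, u₃)) rfl ⟨rfl, rfl⟩
    simp only [linComb, linExtend] at hb'
    constructor
    · intro j hj
      fin_cases j
      · simpa using hb' 0 0 0 0 1 0 0
      · simpa using hb' 0 0 0 1 0 0 0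
      · simpa using hb' 0 0 0 0 0 1 0
      · simpa using hb' 0 1 0 0 0 0 0
      · simpa using hb' 1 0 0 0 0 0 0
      · simpa using hb' 0 0 1 0 0 0 0
      all_goals exact absurd hj (by decide)
    · simpa using hb' 0 0 0 0 0 0 1
  · rintro ⟨hξ, hψ, h⟩
    refine isSymmetryOn_of_phi_relations hτ hξ hψ (fun m n S σ hS hσ hD => ?_)
      (fun _ S σ hS hD => ?_) (fun _ S σ hS hD => ?_)
    · rcases h with h | ⟨β, φ₀, hβ, hφ, hper, hb⟩
      · simp [h]
      · refine phi_up_mul_of_quasiperiodic hβ hφ hper hS hσ ?_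
        obtain ⟨h0, h1⟩ := hb m n
        rw [linComb, h0 0 (by decide), h0 1 (by decide), h0 2 (by decide), h0 3 (by decide),
          h0 4 (by decide), h0 5 (by decide), hD.1, hD.2, ← h1]
        ring
    · rcases h with h | ⟨β, φ₀, hβ, hφ, hper, hb⟩
      · simp [h]
      · rw [hφ, hφ, hS.time_right, hD.1]
    · rcases h with h | ⟨β, φ₀, hβ, hφ, hper, hb⟩
      · simp [h]
      · rw [hφ, hφ, hS.time_left, hD.2]

theorem isSymmetryOn_univ_allSolutions_iff (hτ : τ ≠ 0) :
    IsSymmetryOn τ univ univ AllSolutions L X ↔ X.ξ = 0 ∧ X.ψ = 0 ∧ X.φ = 0 := by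
  constructor
  · intro h
    obtain ⟨hξ, hψ⟩ :=
      IsSymmetryOn.xi_psi_eq_zero hτ (h.mono (subset_univ _) fun _ _ => trivial)
    refine ⟨hξ, hψ, funext ?_⟩
    rintro ⟨x, t, w⟩
    -- A horizontal row suffices: if `s` is nonzero at the middle node only, preservation of
    -- `rowRight` reads `φ = 0` at that node.
    have hM : (0 : ℝ) < 1 + 2 * τ * 0 := by simp
    have h1 := HasDerivAt.unique (hasLineDerivAt_rowRight τ x t w 0 0 1 1 _)
      (h 0 0 _ (linExtend (L 0 0) 0 (0, 1, 0) 0) (fun _ => mem_univ _)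
        (burgersScheme_parabolaStencil hτ x t w 0 one_pos one_pos hM) rfl trivial
        .rowRight (mem_univ _))
    simpa [Generator.prolong, linExtend, parabolaStencil] using h1
  · rintro ⟨hξ, hψ, hφ⟩
    exact isSymmetryOn_of_phi_relations hτ hξ hψ (by simp [hφ]) (by simp [hφ]) (by simp [hφ])

end

theorem mainTheorem3 (τ : ℝ) (hτ : τ ≠ 0) :
    -- local form: the `∂_x` and `∂_w` parts vanish, and `φ` depends on `t` only
    (∀ (U : Set Pt) (L : ℤ → ℤ → LinearCoeffs) (X : Generator), IsOpen U →
      IsSymmetryOn τ U stepEqs RowConstant L X →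
        ∀ S : Stencil, (∀ i, S i ∈ U) → BurgersScheme τ S →
          (∀ i, i ≠ Node.up → X.ξ (S i) = 0 ∧ X.ψ (S i) = 0) ∧
          (∀ (m n : ℤ) (σ : Stencil), σ .up = linStep (L m n) σ → RowConstant σ →
            ∀ i, (X.prolong S σ i).1 = 0 ∧ (X.prolong S σ i).2.2 = 0) ∧
          (∀ᶠ p in 𝓝 (S .mid), p.2.1 = (S .mid).2.1 → X.φ p = X.φ (S .mid))) ∧
    -- the equations for the point `(m, n+1)`, arbitrary solutions `(y, s, u)`
    (∀ (L : ℤ → ℤ → LinearCoeffs) (X : Generator),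
      IsSymmetryOn τ univ stepEqs AllSolutions L X ↔
        X.ξ = 0 ∧ X.ψ = 0 ∧
          (X.φ = 0 ∨ ∃ (β : ℝ) (φ₀ : ℝ → ℝ), β ≠ 0 ∧ (∀ p, X.φ p = φ₀ p.2.1) ∧
            (∀ (t : ℝ) (k : ℤ), φ₀ (t + k * τ) = β ^ (-k) * φ₀ t) ∧
            ∀ m n j, (L m n).b j = if j = 6 then β else 0)) ∧
    -- all equations of the scheme, solutions with `s` constant along the rows
    (∀ (L : ℤ → ℤ → LinearCoeffs) (X : Generator),
      IsSymmetryOn τ univ univ RowConstant L X ↔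
        X.ξ = 0 ∧ X.ψ = 0 ∧
          (X.φ = 0 ∨ ∃ (β : ℝ) (φ₀ : ℝ → ℝ), β ≠ 0 ∧ (∀ p, X.φ p = φ₀ p.2.1) ∧
            (∀ (t : ℝ) (k : ℤ), φ₀ (t + k * τ) = β ^ (-k) * φ₀ t) ∧
            ∀ m n, (∀ j, j < 6 → (L m n).b j = 0) ∧
              (L m n).b 6 + (L m n).b 7 + (L m n).b 8 = β)) ∧
    -- all equations of the scheme, arbitrary solutions `(y, s, u)`
    (∀ (L : ℤ → ℤ → LinearCoeffs) (X : Generator),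
      IsSymmetryOn τ univ univ AllSolutions L X ↔ X.ξ = 0 ∧ X.ψ = 0 ∧ X.φ = 0) ∧
    ¬ IsLinearizable (BurgersScheme τ) ∧
    ¬ IsLinearScheme (HeatScheme τ) := by
  refine ⟨fun U L X hU h S hSU hS => ⟨fun i hi => h.lower_eq_zero hτ hU hSU hS hi,
      fun m n σ hσ hD i => h.prolong_eq_zero hτ hU hSU hS hσ hD i,
      h.phi_locally_constant hτ hU hSU hS⟩,
    fun L X => isSymmetryOn_stepEqs_allSolutions_iff hτ,
    fun L X => isSymmetryOn_univ_rowConstant_iff hτ,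
    fun L X => isSymmetryOn_univ_allSolutions_iff hτ,
    not_isLinearizable_burgersScheme hτ, not_isLinearScheme_heatScheme hτ⟩
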